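/- Let $d\ge 2$ and $k>1$ be integers, $j=2d+k-3$, and $$T=(1,2,\ldots,d-1,d^k,d-1,\ldots,2,1),$$ where $d$ occurs $k$ times. Let $\mathsf k$ be an infinite field of characteristic $0$ or greater than $j$, and $R=\mathsf k[x,y]$. Place the monomial $x^{u}y^{r}$ in row $r+1$ (from the top) and column $u+1$ (from the left) of the quarter plane, so that the Ferrers diagram of a partition $P$ (rows are the parts of $P$, in decreasing order) is a set of monomials. The diagonal lengths of $P$ are the numbers of monomials of degree $0,1,2,\ldots$ in its diagram. Let $P$ be a partition with diagonal lengths $T$. We say that $P$ has CIJT (complete intersection Jordan type) if there are a graded Artinian complete intersection $A=R/I$ (that is, $A$ is nonzero and finite dimensional, and $I$ is generated by two homogeneous polynomials) with Hilbert function $T$ and a linear form $\ell\in A_1$ such that the parts of $P$ are the Jordan block sizes of the multiplication by $\ell$ on $A$. The branch label of $P$ is $\mathfrak b=(\mathfrak b(0),\ldots,\mathfrak b(d))$, defined as follows: let $s=\max\{0,k-2\}$, let $\epsilon$ be the largest $i\in\{0,\ldots,d\}$ such that $x^{i}y^{d-i}$ is not in the diagram of $P$, and put $$\mathfrak b(i)=\begin{cases}0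 & i=\epsilon,\\ [\text{length of the }(i+1)\text{-st column of }P]-(d-i)-s & i<\epsilon,\\ [\text{length of the }(i-\epsilon)\text{-th row of }P]-(d-i+\epsilon+1)-s & i>\epsilon.\end{cases}$$ Then $P$ has CIJT if and only if there exist an integer $0\le e\le d$ and, for some $c\ge 0$, an increasing sequence $0=a_0<a_1<\cdots<a_c=d-e$ such that $$\mathfrak b=(\mathfrak v,0,\mathfrak h_1,\ldots,\mathfrak h_c),$$ where $\mathfrak v=(1,2,\ldots,e)$ (empty if $e=0$) and, for $1\le i\le c$, $\mathfrak h_i$ is the interval $\{x\in\mathbb Z\mid d-a_i<x\le d-a_{i-1}\}$ listed in increasing order. -/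

import Mathlib

namespace CIJordan

/-!  A partition is represented by its Ferrers diagram, a `YoungDiagram`.  The cell `(r, c)` (row `r`
from the top, column `c` from the left, both counted from `0`) is the box of the monomial
`x ^ c * y ^ r`; `P.rowLen r` and `P.colLen c` are the lengths of rows and columns. -/

/-- The `i`-th diagonal length of `P`: the number of its boxes whose monomial has degree `i`. -/
def diagLength (P : YoungDiagram) (i : ℕ) : ℕ :=
  (P.cells.filter fun c => c.1 + c.2 = i).card

/-- The sequence `T(d,k) = (1, 2, …, d-1, d, …, d, d-1, …, 2, 1)` in which `d` occurs `k` times,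
indexed by the degree and continued by `0` after the degree `2d+k-3`. -/
def ciSeq (d k i : ℕ) : ℕ :=
  if i < d then i + 1 else if i < d + k - 1 then d else 2 * d + k - 2 - i

section Algebra

variable {K : Type*} [Field K]

/-- The Hilbert function of `A = K[x,y]/I`: the dimension of the image of the forms of degree `i`. -/
noncomputable def hilbertFn (I : Ideal (MvPolynomial (Fin 2) K)) (i : ℕ) : ℕ :=
  Module.finrank K
    ((MvPolynomial.homogeneousSubmodule (Fin 2) K i).map (Ideal.Quotient.mkₐ K I).toLinearMap)

/-- `K[x,y]/I` is a graded Artinian complete intersection: it is nonzero and finite dimensional,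
and `I` is generated by two (the codimension) homogeneous polynomials. -/
def IsGradedCI (I : Ideal (MvPolynomial (Fin 2) K)) : Prop :=
  I ≠ ⊤ ∧ Module.Finite K (MvPolynomial (Fin 2) K ⧸ I) ∧
    ∃ f g : MvPolynomial (Fin 2) K, (∃ m, f.IsHomogeneous m) ∧ (∃ n, g.IsHomogeneous n) ∧
      I = Ideal.span {f, g}

/-- The endomorphism `φ` is nilpotent, and the sizes of its Jordan blocks are the parts of `P`:
there is a basis indexed by the boxes of `P` such that `φ` moves each basis vector to the next one
in its row, and the last one of each row to `0`. -/
def HasJordanType {V : Type*} [AddCommGroup V] [Module K V] (φ : Module.End K V)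
    (P : YoungDiagram) : Prop :=
  ∃ b : Module.Basis P.cells K V, ∀ c : P.cells,
    φ (b c) = if h : (c.1.1, c.1.2 + 1) ∈ P.cells then b ⟨(c.1.1, c.1.2 + 1), h⟩ else 0

variable (K) in
/-- `P`, a partition of diagonal lengths `T`, has complete intersection Jordan type: it is the
Jordan type of the multiplication by some linear form on some graded Artinian complete
intersection quotient of `K[x,y]` of Hilbert function `T`. -/
def IsCIJT (T : ℕ → ℕ) (P : YoungDiagram) : Prop :=
  (∀ i, diagLength P i = T i) ∧
    ∃ I : Ideal (MvPolynomial (Fin 2) K), IsGradedCI I ∧ (∀ i, hilbertFn I i = T i) ∧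
      ∃ l ∈ MvPolynomial.homogeneousSubmodule (Fin 2) K 1,
        HasJordanType (LinearMap.mulLeft K (Ideal.Quotient.mk I l)) P

end Algebra

/-- The position of the highest gap: the largest `i ≤ d` such that the monomial `x ^ i * y ^ (d-i)`
is not a box of `P`. -/
def gapPos (d : ℕ) (P : YoungDiagram) : ℕ :=
  Nat.findGreatest (fun i => (d - i, i) ∉ P) d

/-- The entry `𝔟(i)`, `0 ≤ i ≤ d`, of the branch label of a partition of diagonal lengths
`T(d,k)`. With `e` the position of the highest gap, it is `0` at `i = e`; for `i < e` it is the
excess of the column of index `i` over its part in the basic triangle, and for `i > e` that of the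
row of index `i - e - 1`, both diminished by `s = max {0, k - 2}`. -/
def branchEntry (d k : ℕ) (P : YoungDiagram) (i : ℕ) : ℤ :=
  if i = gapPos d P then 0
  else if i < gapPos d P then
    (P.colLen i : ℤ) - ((d : ℤ) - i) - max 0 ((k : ℤ) - 2)
  else
    (P.rowLen (i - gapPos d P - 1) : ℤ) - ((d : ℤ) - i + gapPos d P + 1) - max 0 ((k : ℤ) - 2)

/-- The branch label `(𝔟(0), …, 𝔟(d))`. -/
def branchLabel (d k : ℕ) (P : YoungDiagram) : List ℤ :=
  (List.range (d + 1)).map (branchEntry d k P)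

/-- The ordered interval `{x | m < x ≤ n}`, listed increasingly. -/
def interval (m n : ℕ) : List ℤ :=
  (List.range' (m + 1) (n - m)).map Nat.cast

end CIJordan

namespace CIJordan

/-! ### Strings for multiplication by a variable -/

section StringBasis

open Polynomial

variable {K : Type*} [Field K]

/-! After a linear change of coordinates the linear form is `X 1`. Dehomogenizing by `X 1 = 1` turns
forms of degree `t` into polynomials of degree at most `t` in one variable. Suppose that for each
`r` there is a polynomial of degree exactly `r` whose degree-`r` homogenization is killed modulo `J`
by the power of `X 1` with exponent the length of row `r` of `Q`. Then the strings of these forms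
span the quotient by `J`, and if they are also independent, its Jordan type is `Q`.

For generators of degrees `d ≤ n` with dehomogenizations `F`, `G`, such polynomials come from the
Euclidean algorithm. Put `e = d - deg F`. The degrees of the successive remainders, read upwards to
`deg F`, are the breakpoints `a i`. The remainder of degree `a i`, multiplied by powers of the
variable, serves all rows `r` with `a i ≤ r < a (i + 1)`, with length `n + d - a i - a (i + 1)`;
multiples of `F` serve the rows up to `n`, with length `e`. This is `rowProfile`, whose sum is `d *
n`.

If `P` has CIJT, comparing this sum with the size of `P` forces `n = d + k - 1`, so the spanning
strings form a basis and `P` has this profile (`rowProfile_of_isCIJT`). Conversely, prescribed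
breakpoints are realized by a continuant with quotients `X ^ (a (i + 1) - a i)`; the Hilbert
function is squeezed between a dimension count for two generators and the diagonal lengths of `P`
(`isCIJT_of_rowProfile`). Finally `branchLabel_eq_iff` and `label_eq_map` translate profiles into
labels. -/

theorem natDegree_aeval_le {f : MvPolynomial (Fin 2) K} {t : ℕ} (hf : f.IsHomogeneous t) :
    (MvPolynomial.aeval ![X, 1] f : K[X]).natDegree ≤ t := by
  rw [f.as_sum, map_sum]
  refine natDegree_sum_le_of_forall_le _ _ fun m hm => ?_
  have hm' : m 0 + m 1 = t := by
    have := hf.degree_eq_sum_deg_support hm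
    rw [this, ← Finsupp.degree_apply, Finsupp.degree_eq_sum, Fin.sum_univ_two]
  rw [MvPolynomial.aeval_monomial]
  simp only [Finsupp.prod_fintype, pow_zero, implies_true, Fin.prod_univ_two]
  refine (natDegree_C_mul_le _ _).trans ?_
  simp
  omega

/-- The polynomials of degree at most `t` whose homogenization in degree `t` lies in `J`. -/
noncomputable def affinePart (J : Ideal (MvPolynomial (Fin 2) K)) (t : ℕ) : Submodule K K[X] where
  carrier := {h | h.natDegree ≤ t ∧ h.homogenize t ∈ J}
  zero_mem' := by simp
  add_mem' := by
    rintro a b ⟨ha, ha'⟩ ⟨hb, hb'⟩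
    exact ⟨natDegree_add_le_of_degree_le ha hb, by simpa using J.add_mem ha' hb'⟩
  smul_mem' := by
    rintro c a ⟨ha, ha'⟩
    refine ⟨(natDegree_smul_le c a).trans ha, ?_⟩
    rw [homogenize_smul, MvPolynomial.smul_eq_C_mul]
    exact J.mul_mem_left _ ha'

variable {J : Ideal (MvPolynomial (Fin 2) K)}

/-- Homogenization is multiplicative under degree bounds, and the surplus `s - i - t` is put into
the homogenization of `q`. All later degree bookkeeping rests on this. -/
theorem mul_mem_affinePart {q h : K[X]} {i t s : ℕ} (hq : q.natDegree ≤ i)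
    (hh : h ∈ affinePart J t) (hs : i + t ≤ s) : q * h ∈ affinePart J s := by
  obtain ⟨j, rfl⟩ := Nat.exists_eq_add_of_le hs
  have hq' : q.natDegree ≤ i + j := by omega
  refine ⟨natDegree_mul_le.trans (by have := hh.1; omega), ?_⟩
  rw [show i + t + j = i + j + t by omega, homogenize_mul _ _ hq' hh.1]
  exact J.mul_mem_left _ hh.2

theorem affinePart_mono {t s : ℕ} (hs : t ≤ s) : affinePart J t ≤ affinePart J s := fun h hh => by
  simpa using mul_mem_affinePart (q := 1) (i := 0) (by simp) hh (by omega)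

theorem homogenize_add_eq (h : K[X]) {r : ℕ} (hr : h.natDegree ≤ r) (u : ℕ) :
    h.homogenize (u + r) = MvPolynomial.X 1 ^ u * h.homogenize r := by
  have := homogenize_mul (1 : K[X]) h (m := u) (by simp) hr
  rwa [one_mul, homogenize_one] at this

/-- The class of `x ^ u * h_r`, where `(r, u)` is a box and `h_r` is homogenized in degree `r`. -/
noncomputable def stringVec (J : Ideal (MvPolynomial (Fin 2) K)) (h : ℕ → K[X]) (c : ℕ × ℕ) :
    MvPolynomial (Fin 2) K ⧸ J :=
  Ideal.Quotient.mk J (MvPolynomial.X 1 ^ c.2 * (h c.1).homogenize c.1)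

/-- `h` consists of polynomials of all degrees, the one of degree `r` being a generator of a string
of length at most `Q.rowLen r` modulo `J`. -/
structure IsStringSystem (J : Ideal (MvPolynomial (Fin 2) K)) (Q : YoungDiagram)
    (h : ℕ → K[X]) : Prop where
  natDegree_eq : ∀ r, (h r).natDegree = r
  ne_zero : ∀ r, h r ≠ 0
  mem : ∀ r, h r ∈ affinePart J (Q.rowLen r + r)

namespace IsStringSystem

variable {Q : YoungDiagram} {h : ℕ → K[X]}

theorem stringVec_eq (H : IsStringSystem J Q h) (r u : ℕ) :
    stringVec J h (r, u) = Ideal.Quotient.mk J ((h r).homogenize (u + r)) := by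
  rw [stringVec, homogenize_add_eq _ (H.natDegree_eq r).le]

theorem stringVec_eq_zero (H : IsStringSystem J Q h) {r u : ℕ} (hc : (r, u) ∉ Q) :
    stringVec J h (r, u) = 0 := by
  rw [H.stringVec_eq, Ideal.Quotient.eq_zero_iff_mem]
  rw [YoungDiagram.mem_iff_lt_rowLen, not_lt] at hc
  exact (affinePart_mono (by omega) (H.mem r)).2

/-- The `h r` with `r ≤ t` form a triangular basis of the polynomials of degree at most `t`, so
leading terms can be cancelled one at a time; a term outside the diagram vanishes modulo `J`. -/
theorem mk_homogenize_mem_span (H : IsStringSystem J Q h) (t : ℕ) (q : K[X])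
    (hq : q.natDegree ≤ t) :
    Ideal.Quotient.mk J (q.homogenize t) ∈
      Submodule.span K (stringVec J h '' {c | c ∈ Q.cells ∧ c.1 + c.2 = t}) := by
  suffices ∀ s : ℕ, ∀ q : K[X], q.degree < s → q.natDegree ≤ t → Ideal.Quotient.mk J (q.homogenize t) ∈
      Submodule.span K (stringVec J h '' {c | c ∈ Q.cells ∧ c.1 + c.2 = t}) from
    this (q.natDegree + 1) q (degree_le_natDegree.trans_lt (by exact_mod_cast Nat.lt_succ_self _)) hq
  intro s
  induction s with
  | zero =>
    intro q hq _
    have : q = 0 := degree_eq_bot.1 (Nat.WithBot.lt_zero_iff.1 (by simpa using hq))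
    simp [this]
  | succ s ih =>
    intro q hq hqt
    rcases lt_or_ge q.degree (s : WithBot ℕ) with hlt | hge
    · exact ih q hlt hqt
    have hq0 : q ≠ 0 := fun h0 => by simp [h0] at hge
    have hs : q.degree = s := by
      rw [degree_eq_natDegree hq0] at hq hge ⊢
      norm_cast at hq hge ⊢
      omega
    have hsn : q.natDegree = s := natDegree_eq_of_degree_eq_some hs
    set c : K := q.leadingCoeff / (h s).leadingCoeff with hc
    have hl : (h s).leadingCoeff ≠ 0 := leadingCoeff_ne_zero.2 (H.ne_zero s)
    have hc0 : c ≠ 0 := div_ne_zero (leadingCoeff_ne_zero.2 hq0) hl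
    have hdeg : q.degree = (c • h s).degree := by
      rw [degree_smul_of_smul_regular _ (IsSMulRegular.of_ne_zero hc0), hs,
        degree_eq_natDegree (H.ne_zero s), H.natDegree_eq]
    have hlt : (q - c • h s).degree < s := by
      rw [← hs]
      refine degree_sub_lt_left hdeg hq0 ?_
      rw [smul_eq_C_mul, leadingCoeff_mul, leadingCoeff_C, hc, div_mul_cancel₀ _ hl]
    have hst : (q - c • h s).natDegree ≤ t := by
      refine (natDegree_sub_le _ _).trans (max_le hqt ((natDegree_smul_le c (h s)).trans ?_))
      rwa [H.natDegree_eq, ← hsn]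
    have hsub := ih (q - c • h s) hlt hst
    have hdecomp : Ideal.Quotient.mk J (q.homogenize t) =
        Ideal.Quotient.mk J ((q - c • h s).homogenize t) + c • stringVec J h (s, t - s) := by
      rw [H.stringVec_eq, Nat.sub_add_cancel (by omega), homogenize_sub, homogenize_smul]
      simp only [map_sub]
      rw [← Ideal.Quotient.mkₐ_eq_mk K J, map_smul]
      simp
    rw [hdecomp]
    refine Submodule.add_mem _ hsub (Submodule.smul_mem _ _ ?_)
    by_cases hcell : (s, t - s) ∈ Q
    · exact Submodule.subset_span ⟨_, ⟨hcell, by simp; omega⟩, rfl⟩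
    · rw [H.stringVec_eq_zero hcell]
      exact Submodule.zero_mem _

theorem map_homogeneousSubmodule_le (H : IsStringSystem J Q h) (t : ℕ) :
    (MvPolynomial.homogeneousSubmodule (Fin 2) K t).map (Ideal.Quotient.mkₐ K J).toLinearMap ≤
      Submodule.span K (stringVec J h '' {c | c ∈ Q.cells ∧ c.1 + c.2 = t}) := by
  rintro _ ⟨f, hf, rfl⟩
  have hf' : f.IsHomogeneous t := hf
  set q : K[X] := MvPolynomial.aeval ![X, 1] f with hq
  have hqf : q.homogenize t = f := homogenize_eq_of_isHomogeneous hf' hq.symm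
  rw [← hqf]
  exact H.mk_homogenize_mem_span t q (natDegree_aeval_le hf')

theorem span_eq_top (H : IsStringSystem J Q h) :
    ⊤ ≤ Submodule.span K (Set.range fun c : Q.cells => stringVec J h c) := by
  rintro v -
  obtain ⟨f, rfl⟩ := Ideal.Quotient.mk_surjective v
  rw [← MvPolynomial.sum_homogeneousComponent f, map_sum]
  refine Submodule.sum_mem _ fun t _ => ?_
  refine Submodule.span_mono ?_ (H.map_homogeneousSubmodule_le t
    ⟨_, MvPolynomial.homogeneousComponent_mem t f, rfl⟩)
  rintro _ ⟨c, ⟨hc, -⟩, rfl⟩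
  exact ⟨⟨c, hc⟩, rfl⟩

theorem finite (H : IsStringSystem J Q h) : Module.Finite K (MvPolynomial (Fin 2) K ⧸ J) :=
  ⟨⟨_, by
    rw [← top_le_iff, (Set.finite_range fun c : Q.cells => stringVec J h c).coe_toFinset]
    exact H.span_eq_top⟩⟩

theorem hilbertFn_le (H : IsStringSystem J Q h) (t : ℕ) : hilbertFn J t ≤ diagLength Q t := by
  classical
  have hset : stringVec J h '' {c | c ∈ Q.cells ∧ c.1 + c.2 = t} =
      ((Q.cells.filter fun c => c.1 + c.2 = t).image (stringVec J h) : Finset _) := by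
    ext; simp
  have hle := H.map_homogeneousSubmodule_le t
  rw [hset] at hle
  exact (Submodule.finrank_mono hle).trans
    ((finrank_span_finset_le_card _).trans Finset.card_image_le)

theorem hasJordanType (H : IsStringSystem J Q h)
    (hli : LinearIndependent K fun c : Q.cells => stringVec J h c) :
    HasJordanType (LinearMap.mulLeft K (Ideal.Quotient.mk J (MvPolynomial.X 1))) Q := by
  refine ⟨Module.Basis.mk hli H.span_eq_top, ?_⟩
  rintro ⟨⟨r, u⟩, hc⟩
  have key : Ideal.Quotient.mk J (MvPolynomial.X 1) * stringVec J h (r, u) =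
      stringVec J h (r, u + 1) := by
    rw [stringVec, stringVec, ← map_mul, pow_succ', mul_assoc]
  simp only [Module.Basis.mk_apply, LinearMap.mulLeft_apply, key]
  split_ifs with h1
  · rfl
  · exact H.stringVec_eq_zero h1

theorem hasJordanType_of_finrank (H : IsStringSystem J Q h)
    (hcard : Q.cells.card = Module.finrank K (MvPolynomial (Fin 2) K ⧸ J)) :
    HasJordanType (LinearMap.mulLeft K (Ideal.Quotient.mk J (MvPolynomial.X 1))) Q :=
  H.hasJordanType (linearIndependent_of_top_le_span_of_card_eq_finrank H.span_eq_top
    (by simpa using hcard))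

end IsStringSystem

end StringBasis

end CIJordan

namespace CIJordan

/-! ### Hilbert functions of ideals with two homogeneous generators -/

section HilbertFunction

variable {K : Type*} [Field K]

open MvPolynomial

attribute [local instance] MvPolynomial.gradedAlgebra

variable (K) in
/-- Homogenization identifies the polynomials of degree at most `t` with the forms of degree `t`. -/
noncomputable def homogenizeEquiv (t : ℕ) :
    Polynomial.degreeLT K (t + 1) ≃ₗ[K] homogeneousSubmodule (Fin 2) K t :=
  LinearEquiv.ofBijective
    (((Polynomial.homogenizeLM t).domRestrict _).codRestrict _ fun p =>
      Polynomial.isHomogeneous_homogenize (n := t) p.1) <| by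
    constructor
    · rw [injective_iff_map_eq_zero]
      rintro ⟨p, hp⟩ h0
      have hp' : p.natDegree ≤ t := by
        rw [Polynomial.mem_degreeLT] at hp
        rcases eq_or_ne p 0 with rfl | h0
        · simp
        · exact Nat.lt_succ_iff.1 ((Polynomial.natDegree_lt_iff_degree_lt h0).2 hp)
      have := congrArg Subtype.val h0
      exact Subtype.ext (Polynomial.eq_zero_of_homogenize_eq_zero hp' this)
    · rintro ⟨f, hf⟩
      have hf' : f.IsHomogeneous t := hf
      refine ⟨⟨aeval ![Polynomial.X, 1] f, ?_⟩,
        Subtype.ext (Polynomial.homogenize_eq_of_isHomogeneous hf' rfl)⟩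
      rw [Polynomial.mem_degreeLT]
      refine (Polynomial.degree_le_natDegree.trans
        (Nat.cast_le.2 (natDegree_aeval_le hf'))).trans_lt ?_
      exact_mod_cast Nat.lt_succ_self t

instance (t : ℕ) : Module.Finite K (homogeneousSubmodule (Fin 2) K t) :=
  Module.Finite.equiv (homogenizeEquiv K t)

theorem finrank_homogeneousSubmodule (t : ℕ) :
    Module.finrank K (homogeneousSubmodule (Fin 2) K t) = t + 1 := by
  rw [← (homogenizeEquiv K t).finrank_eq, (Polynomial.degreeLTEquiv K (t + 1)).finrank_eq]
  simp

theorem hilbertFn_add_finrank_inf (I : Ideal (MvPolynomial (Fin 2) K)) (t : ℕ) :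
    hilbertFn I t + Module.finrank K
      (homogeneousSubmodule (Fin 2) K t ⊓ I.restrictScalars K : Submodule K _) = t + 1 := by
  set φ := (Ideal.Quotient.mkₐ K I).toLinearMap.domRestrict (homogeneousSubmodule (Fin 2) K t)
  have h := φ.finrank_range_add_finrank_ker
  rw [finrank_homogeneousSubmodule] at h
  have h1 : hilbertFn I t = Module.finrank K (LinearMap.range φ) := by
    rw [hilbertFn, LinearMap.range_domRestrict]
  have h2 : (homogeneousSubmodule (Fin 2) K t ⊓ I.restrictScalars K : Submodule K _) =
      (LinearMap.ker φ).map (Submodule.subtype _) := by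
    ext x
    simp only [Submodule.mem_inf, Submodule.restrictScalars_mem, Submodule.mem_map,
      LinearMap.mem_ker, φ, LinearMap.domRestrict_apply, AlgHom.toLinearMap_apply,
      Ideal.Quotient.mkₐ_eq_mk, Ideal.Quotient.eq_zero_iff_mem, Submodule.subtype_apply]
    constructor
    · rintro ⟨hx, hI⟩
      exact ⟨⟨x, hx⟩, hI, rfl⟩
    · rintro ⟨y, hI, rfl⟩
      exact ⟨y.2, hI⟩
  rwa [h1, h2, Submodule.finrank_map_subtype_eq]

/-- The multiples in degree `t` of a form `f` of degree `m`. -/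
noncomputable def multiples (f : MvPolynomial (Fin 2) K) (m t : ℕ) :
    Submodule K (MvPolynomial (Fin 2) K) :=
  if m ≤ t then (homogeneousSubmodule (Fin 2) K (t - m)).map (LinearMap.mulLeft K f) else ⊥

instance (f : MvPolynomial (Fin 2) K) (m t : ℕ) : Module.Finite K (multiples f m t) := by
  by_cases h : m ≤ t
  · rw [multiples, if_pos h]
    infer_instance
  · rw [multiples, if_neg h]
    infer_instance

theorem finrank_multiples_le (f : MvPolynomial (Fin 2) K) (m t : ℕ) :
    Module.finrank K (multiples f m t) ≤ t + 1 - m := by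
  by_cases h : m ≤ t
  · rw [multiples, if_pos h]
    refine (Submodule.finrank_map_le (LinearMap.mulLeft K f) _).trans ?_
    rw [finrank_homogeneousSubmodule]
    omega
  · rw [multiples, if_neg h]
    simp

theorem homogeneousComponent_mul_mem_multiples {f : MvPolynomial (Fin 2) K} {m : ℕ}
    (hf : f.IsHomogeneous m) (a : MvPolynomial (Fin 2) K) (t : ℕ) :
    homogeneousComponent t (a * f) ∈ multiples f m t := by
  have key : ∀ b, homogeneousComponent t b =
      (DirectSum.decompose (homogeneousSubmodule (Fin 2) K) b t : MvPolynomial (Fin 2) K) := by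
    intro b
    exact (decomposition.decompose'_apply b t).symm
  unfold multiples
  rw [key]
  split_ifs with h
  · rw [DirectSum.coe_decompose_mul_of_right_mem_of_le (homogeneousSubmodule (Fin 2) K) hf h]
    exact ⟨_, (DirectSum.decompose (homogeneousSubmodule (Fin 2) K) a (t - m)).2, mul_comm _ _⟩
  · rw [DirectSum.coe_decompose_mul_of_right_mem_of_not_le (homogeneousSubmodule (Fin 2) K) hf h]
    exact Submodule.zero_mem _

theorem inf_span_pair_le {f g : MvPolynomial (Fin 2) K} {m n : ℕ} (hf : f.IsHomogeneous m)
    (hg : g.IsHomogeneous n) (t : ℕ) :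
    (homogeneousSubmodule (Fin 2) K t ⊓ (Ideal.span {f, g}).restrictScalars K : Submodule K _) ≤
      multiples f m t ⊔ multiples g n t := by
  rintro z ⟨hz, hI⟩
  obtain ⟨a, b, rfl⟩ := Ideal.mem_span_pair.1 hI
  rw [← homogeneousComponent_eq_self hz, map_add]
  exact Submodule.add_mem_sup (homogeneousComponent_mul_mem_multiples hf a t)
    (homogeneousComponent_mul_mem_multiples hg b t)

/-- In degree `t` the ideal is contained in the sum of the multiples of `f` and of `g`, of
dimensions at most `t + 1 - m` and `t + 1 - n`. The truncated subtraction covers generators of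
degree above `t`. -/
theorem le_hilbertFn_span_pair {f g : MvPolynomial (Fin 2) K} {m n : ℕ} (hf : f.IsHomogeneous m)
    (hg : g.IsHomogeneous n) (t : ℕ) :
    t + 1 ≤ hilbertFn (Ideal.span {f, g}) t + (t + 1 - m) + (t + 1 - n) := by
  have h1 := Submodule.finrank_mono (inf_span_pair_le hf hg t)
  have h2 := Submodule.finrank_add_le_finrank_add_finrank (multiples f m t) (multiples g n t)
  have h3 := finrank_multiples_le f m t
  have h4 := finrank_multiples_le g n t
  have h5 := hilbertFn_add_finrank_inf (Ideal.span {f, g}) t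
  omega

theorem hilbertFn_lt_of_mem {I : Ideal (MvPolynomial (Fin 2) K)} {f : MvPolynomial (Fin 2) K}
    {m : ℕ} (hf : f.IsHomogeneous m) (hfI : f ∈ I) (h0 : f ≠ 0) : hilbertFn I m < m + 1 := by
  rw [← hilbertFn_add_finrank_inf I m]
  have : 0 < Module.finrank K
      (homogeneousSubmodule (Fin 2) K m ⊓ I.restrictScalars K : Submodule K _) :=
    Module.finrank_pos_iff_exists_ne_zero.2 ⟨⟨f, hf, hfI⟩, fun h => h0 (congrArg Subtype.val h)⟩
  omega

theorem mem_of_hilbertFn_eq_zero {I : Ideal (MvPolynomial (Fin 2) K)}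
    {m : ℕ} (hI : hilbertFn I m = 0) {f : MvPolynomial (Fin 2) K} (hf : f.IsHomogeneous m) :
    f ∈ I := by
  have h := hilbertFn_add_finrank_inf I m
  rw [hI, zero_add, ← finrank_homogeneousSubmodule (K := K)] at h
  have := Submodule.eq_of_le_of_finrank_eq inf_le_left h
  have hf' : f ∈ homogeneousSubmodule (Fin 2) K m := hf
  rw [← this] at hf'
  exact hf'.2

/-- Generators of an ideal with the Hilbert function of a complete intersection. -/
theorem exists_generators {d k : ℕ} (hd : 2 ≤ d) (hk : 1 < k)
    {I : Ideal (MvPolynomial (Fin 2) K)} (hI : IsGradedCI I)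
    (hT : ∀ i, hilbertFn I i = ciSeq d k i) :
    ∃ (f g : MvPolynomial (Fin 2) K) (n : ℕ), I = Ideal.span {f, g} ∧ f.IsHomogeneous d ∧ f ≠ 0 ∧
      g.IsHomogeneous n ∧ d ≤ n ∧ n ≤ d + k - 1 := by
  obtain ⟨-, -, f, g, ⟨m, hf⟩, ⟨n, hg⟩, hspan⟩ := hI
  have hle : ∀ {z : MvPolynomial (Fin 2) K} {t : ℕ}, z.IsHomogeneous t → z ∈ I → z ≠ 0 → d ≤ t := by
    intro z t hz hzI h0
    by_contra! hlt
    have := hilbertFn_lt_of_mem hz hzI h0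
    rw [hT, ciSeq, if_pos hlt] at this
    omega
  have hfI : f ∈ I := hspan ▸ Ideal.subset_span (by simp)
  have hgI : g ∈ I := hspan ▸ Ideal.subset_span (by simp)
  have hTd : ciSeq d k d = d := by
    rw [ciSeq, if_neg (by omega), if_pos (by omega)]
  have hTn : ciSeq d k (d + k - 1) = d - 1 := by
    rw [ciSeq, if_neg (by omega), if_neg (by omega)]
    omega
  have main : ∀ {f g : MvPolynomial (Fin 2) K} {n : ℕ}, I = Ideal.span {f, g} → f.IsHomogeneous d →
      f ≠ 0 → g.IsHomogeneous n → g ∈ I → ∃ (f g : MvPolynomial (Fin 2) K) (n : ℕ),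
        I = Ideal.span {f, g} ∧ f.IsHomogeneous d ∧ f ≠ 0 ∧
        g.IsHomogeneous n ∧ d ≤ n ∧ n ≤ d + k - 1 := by
    intro f g n hspan hf hf0 hg hgI
    by_cases hg0 : g = 0
    -- The zero form is homogeneous of every degree, so `d` is an admissible default.
    · exact ⟨f, g, d, hspan, hf, hf0, hg0 ▸ isHomogeneous_zero _ _ _, le_rfl, by omega⟩
    · refine ⟨f, g, n, hspan, hf, hf0, hg, hle hg hgI hg0, ?_⟩
      -- If `n` exceeded `d + k - 1`, the multiples of `f` alone would leave dimension at least `d`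
      -- in this degree, where the sequence has dropped to `d - 1`.
      have := le_hilbertFn_span_pair hf hg (d + k - 1)
      rw [← hspan, hT, hTn] at this
      omega
  have hdeg : ∀ {z : MvPolynomial (Fin 2) K} {t : ℕ}, z.IsHomogeneous t → z ∈ I →
      (z.IsHomogeneous d ∧ z ≠ 0) ∨ ∃ s, d < s ∧ z.IsHomogeneous s := by
    intro z t hz hzI
    by_cases hz0 : z = 0
    · exact Or.inr ⟨d + 1, by omega, hz0 ▸ isHomogeneous_zero _ _ _⟩
    · rcases (hle hz hzI hz0).eq_or_lt with rfl | hlt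
      · exact Or.inl ⟨hz, hz0⟩
      · exact Or.inr ⟨t, hlt, hz⟩
  rcases hdeg hf hfI with ⟨hfd, hf0⟩ | ⟨m', hm', hf'⟩
  · exact main hspan hfd hf0 hg hgI
  rcases hdeg hg hgI with ⟨hgd, hg0⟩ | ⟨n', hn', hg'⟩
  · exact main (by rw [hspan, Set.pair_comm]) hgd hg0 hf hfI
  -- With both degrees above `d`, the Hilbert function at `d` would be `d + 1`.
  have := le_hilbertFn_span_pair hf' hg' d
  rw [← hspan, hT, hTd] at this
  omega

/-- If the Hilbert function is at least the sequence of diagonal lengths of `Q`, the strings are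
linearly independent. -/
theorem IsStringSystem.linearIndependent {J : Ideal (MvPolynomial (Fin 2) K)} {Q : YoungDiagram}
    {h : ℕ → Polynomial K} (H : IsStringSystem J Q h)
    (hJ : J.IsHomogeneous (homogeneousSubmodule (Fin 2) K))
    (hQ : ∀ i, diagLength Q i ≤ hilbertFn J i) :
    LinearIndependent K fun c : Q.cells => stringVec J h c := by
  classical
  have hfin := H.finite
  -- On each diagonal the vectors span the degree-`t` part, whose dimension is at least their
  -- number.
  have hdegree : ∀ t, LinearIndependent K
      fun c : Q.cells.filter (fun c => c.1 + c.2 = t) => stringVec J h c := by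
    intro t
    rw [linearIndependent_iff_card_le_finrank_span]
    simp only [Fintype.card_coe]
    refine (hQ t).trans (Submodule.finrank_mono ?_)
    refine (H.map_homogeneousSubmodule_le t).trans (Submodule.span_mono ?_)
    rintro _ ⟨c, hc, rfl⟩
    exact ⟨⟨c, by simpa using hc⟩, rfl⟩
  -- As `J` is homogeneous, projection to degree `t` descends to the quotient and splits a relation
  -- into its diagonals.
  let π (t : ℕ) : (MvPolynomial (Fin 2) K ⧸ J) →ₗ[K] (MvPolynomial (Fin 2) K ⧸ J) :=
    (J.restrictScalars K).mapQ (J.restrictScalars K) (homogeneousComponent t) fun z hz =>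
      homogeneousComponent_mem_of_mem hJ hz t
  have hπ : ∀ t (c : ℕ × ℕ), π t (stringVec J h c) = if c.1 + c.2 = t then stringVec J h c else 0 := by
    rintro t ⟨r, u⟩
    rw [H.stringVec_eq]
    change Ideal.Quotient.mk J (homogeneousComponent t _) = _
    rw [homogeneousComponent_of_mem (Polynomial.isHomogeneous_homogenize (n := u + r) (h r))]
    have : (t = u + r) = (r + u = t) := propext (by omega)
    simp only [this]
    split_ifs <;> simp
  rw [Fintype.linearIndependent_iff]
  intro a ha c
  have hc := congrArg (π (c.1.1 + c.1.2)) ha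
  rw [map_sum, map_zero] at hc
  simp only [map_smul, hπ, smul_ite, smul_zero] at hc
  let a' : ℕ × ℕ → K := fun x => if hx : x ∈ Q.cells then a ⟨x, hx⟩ else 0
  have ha' : ∀ x : Q.cells, a x = a' x := fun x => by simp [a']
  simp only [ha'] at hc
  rw [Finset.sum_coe_sort Q.cells (fun x => if x.1 + x.2 = c.1.1 + c.1.2 then
    a' x • stringVec J h x else 0), ← Finset.sum_filter, ← Finset.sum_coe_sort] at hc
  rw [ha']
  exact Fintype.linearIndependent_iff.1 (hdegree _) (fun x => a' x) hc
    ⟨c.1, by simp⟩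

end HilbertFunction

end CIJordan

namespace CIJordan

/-! ### Uniqueness of the Jordan type -/

section JordanType

variable {K : Type*} [Field K] {V W : Type*} [AddCommGroup V] [Module K V] [AddCommGroup W]
  [Module K W]

theorem _root_.YoungDiagram.ext_of_colLen {P Q : YoungDiagram} (h : ∀ c, P.colLen c = Q.colLen c) :
    P = Q := by
  refine YoungDiagram.ext (Finset.ext ?_)
  rintro ⟨r, c⟩
  rw [YoungDiagram.mem_cells, YoungDiagram.mem_cells, YoungDiagram.mem_iff_lt_colLen,
    YoungDiagram.mem_iff_lt_colLen, h]

theorem HasJordanType.finrank_eq {φ : Module.End K V} {P : YoungDiagram} (h : HasJordanType φ P) :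
    Module.finrank K V = P.cells.card := by
  obtain ⟨b, -⟩ := h
  rw [Module.finrank_eq_card_basis b, Fintype.card_coe]

theorem pow_apply_of_basis {φ : Module.End K V} {P : YoungDiagram} {b : Module.Basis P.cells K V}
    (hb : ∀ c : P.cells,
      φ (b c) = if h : (c.1.1, c.1.2 + 1) ∈ P.cells then b ⟨(c.1.1, c.1.2 + 1), h⟩ else 0)
    (c : ℕ) (x : P.cells) :
    (φ ^ c) (b x) = if h : (x.1.1, x.1.2 + c) ∈ P.cells then b ⟨(x.1.1, x.1.2 + c), h⟩ else 0 := by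
  induction c with
  | zero => simp
  | succ c ih =>
    rw [pow_succ', Module.End.mul_apply, ih]
    by_cases h1 : (x.1.1, x.1.2 + c) ∈ P.cells
    · rw [dif_pos h1, hb]
      rfl
    · have h2 : (x.1.1, x.1.2 + (c + 1)) ∉ P.cells := fun h2 =>
        h1 (P.up_left_mem le_rfl (by omega) h2)
      rw [dif_neg h1, dif_neg h2, map_zero]

theorem HasJordanType.finrank_range_pow {φ : Module.End K V} {P : YoungDiagram}
    (h : HasJordanType φ P) (c : ℕ) :
    Module.finrank K (LinearMap.range (φ ^ c)) = (P.cells.filter fun x => c ≤ x.2).card := by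
  classical
  obtain ⟨b, hb⟩ := h
  let ι : P.cells.filter (fun x => c ≤ x.2) → P.cells :=
    fun y => ⟨y.1, (Finset.mem_filter.1 y.2).1⟩
  have hι : Function.Injective ι := fun y z hyz =>
    Subtype.ext (congrArg (fun w : P.cells => w.1) hyz)
  have hrange : LinearMap.range (φ ^ c) = Submodule.span K (Set.range (b ∘ ι)) := by
    rw [LinearMap.range_eq_map, ← b.span_eq, Submodule.map_span, ← Set.range_comp]
    apply le_antisymm <;> rw [Submodule.span_le]
    · rintro _ ⟨x, rfl⟩
      rw [Function.comp_apply, pow_apply_of_basis hb]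
      by_cases h1 : (x.1.1, x.1.2 + c) ∈ P.cells
      · rw [dif_pos h1]
        exact Submodule.subset_span ⟨⟨_, Finset.mem_filter.2 ⟨h1, Nat.le_add_left _ _⟩⟩, rfl⟩
      · rw [dif_neg h1]
        exact Submodule.zero_mem _
    · rintro _ ⟨⟨⟨r, u⟩, hy⟩, rfl⟩
      obtain ⟨h1, h2⟩ := Finset.mem_filter.1 hy
      obtain ⟨v, rfl⟩ : ∃ v, u = v + c := ⟨u - c, (Nat.sub_add_cancel h2).symm⟩
      have h3 : (r, v) ∈ P.cells := P.up_left_mem le_rfl (Nat.le_add_right v c) h1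
      refine Submodule.subset_span ⟨⟨(r, v), h3⟩, ?_⟩
      rw [Function.comp_apply, pow_apply_of_basis hb]
      exact dif_pos h1
  rw [hrange, finrank_span_eq_card (b.linearIndependent.comp ι hι), Fintype.card_coe]

/-- The rank of `φ ^ c` counts the boxes in columns of index at least `c`, so consecutive
differences of ranks recover the column lengths. -/
theorem HasJordanType.unique {φ : Module.End K V} {P Q : YoungDiagram} (hP : HasJordanType φ P)
    (hQ : HasJordanType φ Q) : P = Q := by
  have key : ∀ (P : YoungDiagram) (c : ℕ), (P.cells.filter fun x => c ≤ x.2).card =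
      P.colLen c + (P.cells.filter fun x => c + 1 ≤ x.2).card := by
    intro P c
    rw [YoungDiagram.colLen_eq_card, YoungDiagram.col, ← Finset.card_union_of_disjoint]
    · congr 1
      ext x
      simp only [Finset.mem_filter, Finset.mem_union, ← and_or_left]
      exact and_congr_right fun _ => by omega
    · exact Finset.disjoint_filter.2 fun x _ h => by omega
  refine YoungDiagram.ext_of_colLen fun c => ?_
  have h1 := key P c
  have h2 := key Q c
  rw [← hP.finrank_range_pow, ← hP.finrank_range_pow] at h1
  rw [← hQ.finrank_range_pow, ← hQ.finrank_range_pow] at h2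
  omega

theorem HasJordanType.conj {φ : Module.End K V} {P : YoungDiagram} (hP : HasJordanType φ P)
    {χ : Module.End K W} (e : V ≃ₗ[K] W) (he : ∀ v, e (φ v) = χ (e v)) : HasJordanType χ P := by
  obtain ⟨b, hb⟩ := hP
  refine ⟨b.map e, fun c => ?_⟩
  rw [Module.Basis.map_apply, ← he, hb]
  split_ifs <;> simp

end JordanType

/-! ### Linear changes of coordinates -/

section Coordinates

variable {K : Type*} [Field K]

open MvPolynomial

/-- A nonzero linear form is the image of `X 1` under a linear change of coordinates. -/
theorem exists_coordinates {l : MvPolynomial (Fin 2) K} (hl : l.IsHomogeneous 1) (h0 : l ≠ 0) :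
    ∃ ψ : MvPolynomial (Fin 2) K ≃ₐ[K] MvPolynomial (Fin 2) K, ψ (X 1) = l ∧
      (∀ f t, f.IsHomogeneous t → (ψ f).IsHomogeneous t) ∧
      ∀ f t, f.IsHomogeneous t → (ψ.symm f).IsHomogeneous t := by
  have hspan : l ∈ homogeneousSubmodule (Fin 2) K 1 := hl
  rw [homogeneousSubmodule_one_eq_span_X, Submodule.mem_span_range_iff_exists_fun] at hspan
  obtain ⟨a, rfl⟩ := hspan
  rw [Fin.sum_univ_two] at h0 ⊢
  have hlin : ∀ α β : K, (C α * X 0 + C β * X 1 : MvPolynomial (Fin 2) K).IsHomogeneous 1 :=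
    fun α β => (isHomogeneous_C_mul_X _ _).add (isHomogeneous_C_mul_X _ _)
  have hom : ∀ v : Fin 2 → MvPolynomial (Fin 2) K, (∀ i, (v i).IsHomogeneous 1) → ∀ (f : MvPolynomial (Fin 2) K) t,
      f.IsHomogeneous t → (aeval v f : MvPolynomial (Fin 2) K).IsHomogeneous t :=
      fun v hv f t hf => by simpa using hf.aeval v hv
  by_cases ha : a 1 = 0
  · have ha0 : a 0 ≠ 0 := fun h => h0 (by simp [h, ha])
    have hC : (C (a 0)⁻¹ * C (a 0) : MvPolynomial (Fin 2) K) = 1 := by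
      rw [← C_mul, inv_mul_cancel₀ ha0, C_1]
    refine ⟨AlgEquiv.ofAlgHom (aeval ![X 1, C (a 0) * X 0]) (aeval ![C (a 0)⁻¹ * X 1, X 0]) ?_ ?_,
      ?_, hom _ ?_, hom _ ?_⟩
    · ext i : 1
      fin_cases i
      · simp only [Fin.zero_eta, AlgHom.comp_apply, aeval_X, Matrix.cons_val_zero, map_mul,
          Matrix.cons_val_one, algHom_C, AlgHom.id_apply, algebraMap_eq, ← mul_assoc, hC, one_mul]
      · simp
    · ext i : 1
      fin_cases i
      · simp
      · simp only [Fin.mk_one, AlgHom.comp_apply, aeval_X, Matrix.cons_val_zero, map_mul,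
          Matrix.cons_val_one, algHom_C, AlgHom.id_apply, algebraMap_eq]
        linear_combination X 1 * hC
    · simp [ha, smul_eq_C_mul]
    · intro i
      fin_cases i
      · simpa using isHomogeneous_X K (1 : Fin 2)
      · simpa using isHomogeneous_C_mul_X (a 0) (0 : Fin 2)
    · intro i
      fin_cases i
      · simpa using isHomogeneous_C_mul_X (a 0)⁻¹ (1 : Fin 2)
      · simpa using isHomogeneous_X K (0 : Fin 2)
  · have hC : (C (a 1)⁻¹ * C (a 1) : MvPolynomial (Fin 2) K) = 1 := by
      rw [← C_mul, inv_mul_cancel₀ ha, C_1]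
    refine ⟨AlgEquiv.ofAlgHom (aeval ![X 0, C (a 0) * X 0 + C (a 1) * X 1])
      (aeval ![X 0, C (-((a 1)⁻¹ * a 0)) * X 0 + C (a 1)⁻¹ * X 1]) ?_ ?_,
      ?_, hom _ ?_, hom _ ?_⟩
    · ext i : 1
      fin_cases i
      · simp
      · simp
        linear_combination X 1 * hC
    · ext i : 1
      fin_cases i
      · simp
      · simp
        linear_combination (X 1 - C (a 0) * X 0) * hC
    · simp [smul_eq_C_mul]
    · intro i
      fin_cases i
      · simpa using isHomogeneous_X K (0 : Fin 2)
      · simpa using hlin (a 0) (a 1)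
    · intro i
      fin_cases i
      · simpa using isHomogeneous_X K (0 : Fin 2)
      · simpa using hlin (-((a 1)⁻¹ * a 0)) (a 1)⁻¹

end Coordinates

end CIJordan

namespace CIJordan

/-! ### Breakpoints and the row profile -/

section Breakpoints

/-- The index of the block `[a i, a (i+1))` containing `r`. -/
def blockIdx (a : ℕ → ℕ) (r : ℕ) : ℕ :=
  Nat.findGreatest (fun i => a i ≤ r) r

variable {a : ℕ → ℕ}

theorem apply_blockIdx_le (h0 : a 0 = 0) (r : ℕ) : a (blockIdx a r) ≤ r :=
  Nat.findGreatest_spec (P := fun i => a i ≤ r) (Nat.zero_le r) (by simp [h0])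

theorem lt_apply_blockIdx_succ (ha : StrictMono a) (r : ℕ) : r < a (blockIdx a r + 1) := by
  by_contra! h
  have h1 : blockIdx a r + 1 ≤ r := (ha.id_le _).trans h
  exact Nat.findGreatest_is_greatest (P := fun i => a i ≤ r) (Nat.lt_succ_self _) h1 h

theorem blockIdx_eq (ha : StrictMono a) (h0 : a 0 = 0) {i r : ℕ} (h1 : a i ≤ r)
    (h2 : r < a (i + 1)) : blockIdx a r = i := by
  have h3 := apply_blockIdx_le h0 r
  have h4 := lt_apply_blockIdx_succ ha r
  have h5 := ha.lt_iff_lt.1 (h1.trans_lt h4)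
  have h6 := ha.lt_iff_lt.1 (h3.trans_lt h2)
  omega

theorem blockIdx_mono (ha : StrictMono a) (h0 : a 0 = 0) : Monotone (blockIdx a) := by
  intro r s hrs
  have := ha.lt_iff_lt.1 ((apply_blockIdx_le h0 r).trans_lt
    (hrs.trans_lt (lt_apply_blockIdx_succ ha s)))
  omega

theorem apply_blockIdx_succ_le (ha : StrictMono a) (h0 : a 0 = 0) {c r : ℕ} (h : r < a c) :
    a (blockIdx a r + 1) ≤ a c :=
  ha.monotone (ha.lt_iff_lt.1 ((apply_blockIdx_le h0 r).trans_lt h))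

/-- The row lengths of the Jordan type attached to `e` and to the breakpoints `a`, for a complete
intersection of degrees `d ≤ n`. -/
def rowProfile (d n e : ℕ) (a : ℕ → ℕ) (r : ℕ) : ℕ :=
  if r < d - e then n + d - a (blockIdx a r) - a (blockIdx a r + 1) else if r < n then e else 0

theorem rowProfile_antitone {d n e c : ℕ} (ha : StrictMono a)
    (h0 : a 0 = 0) (hc : a c = d - e) : Antitone (rowProfile d n e a) := by
  intro r s hrs
  have h1 := ha.monotone (blockIdx_mono ha h0 hrs)
  have h2 := ha.monotone (Nat.succ_le_succ (blockIdx_mono ha h0 hrs))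
  have h3 := apply_blockIdx_le h0 r
  have h4 : r < a c → a (blockIdx a r + 1) ≤ a c := apply_blockIdx_succ_le ha h0
  simp only [rowProfile, Nat.succ_eq_add_one] at *
  split_ifs <;> omega

/-- Block `i` contributes `(a (i+1) - a i) * (N - a i - a (i+1))`, a difference of values of `z ↦ N
* z - z ^ 2`, so the sum telescopes. The bound on `N` keeps the subtractions exact. -/
theorem sum_block (ha : StrictMono a) (h0 : a 0 = 0) {N : ℕ} (i : ℕ) (hN : 2 * a i ≤ N) :
    ∑ r ∈ Finset.range (a i), (N - a (blockIdx a r) - a (blockIdx a r + 1)) + a i * a i =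
      N * a i := by
  induction i with
  | zero => simp [h0]
  | succ i ih =>
    have hlt : a i < a (i + 1) := ha (Nat.lt_succ_self i)
    obtain ⟨b, hb⟩ := Nat.exists_eq_add_of_lt hlt
    have hb' : a (i + 1) = a i + (b + 1) := by omega
    have hblock : ∀ x ∈ Finset.range (b + 1), N - a (blockIdx a (a i + x)) -
        a (blockIdx a (a i + x) + 1) = N - a i - a (i + 1) := by
      intro x hx
      rw [blockIdx_eq ha h0 (i := i) (by omega) (by have := Finset.mem_range.1 hx; omega)]
    have ih' := ih (by omega)
    conv_lhs => enter [1]; rw [hb', Finset.sum_range_add, Finset.sum_congr rfl hblock]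
    rw [Finset.sum_const, Finset.card_range, smul_eq_mul]
    obtain ⟨M, hM⟩ := Nat.exists_eq_add_of_le hN
    have h1 : N - a i - a (i + 1) = b + 1 + M := by omega
    rw [h1]
    have hN' : N = 2 * (a i + (b + 1)) + M := by rw [hM, hb']
    rw [hb']
    linear_combination ih' + (b + 1) * hN'.symm

theorem sum_rowProfile {d n e c : ℕ} (hn : d ≤ n) (he : e ≤ d) (ha : StrictMono a)
    (h0 : a 0 = 0) (hc : a c = d - e) :
    ∑ r ∈ Finset.range n, rowProfile d n e a r = d * n := by
  obtain ⟨m, rfl⟩ := Nat.exists_eq_add_of_le' he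
  obtain ⟨q, rfl⟩ := Nat.exists_eq_add_of_le hn
  have hm : m + e - e = m := by omega
  have h1 := sum_block ha h0 (N := m + e + q + (m + e)) c (by omega)
  rw [hc, hm] at h1
  rw [show m + e + q = m + (e + q) by omega, Finset.sum_range_add]
  have h2 : ∀ r ∈ Finset.range m, rowProfile (m + e) (m + (e + q)) e a r =
      m + e + q + (m + e) - a (blockIdx a r) - a (blockIdx a r + 1) := by
    intro r hr
    rw [rowProfile, if_pos (by have := Finset.mem_range.1 hr; omega), ← add_assoc m e q]
  have h3 : ∀ x ∈ Finset.range (e + q), rowProfile (m + e) (m + (e + q)) e a (m + x) = e := by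
    intro r hr
    have := Finset.mem_range.1 hr
    rw [rowProfile, if_neg (by omega), if_pos (by omega)]
  rw [Finset.sum_congr rfl h2, Finset.sum_congr rfl h3, Finset.sum_const, Finset.card_range,
    smul_eq_mul]
  linear_combination h1

end Breakpoints

/-! ### Diagrams from row lengths and box counts -/

section Diagrams

/-- The Young diagram with given row lengths. -/
def diagramOfRows (p : ℕ → ℕ) (hp : Antitone p) (n : ℕ) : YoungDiagram where
  cells := (Finset.range n ×ˢ Finset.range (p 0)).filter fun c => c.2 < p c.1
  isLowerSet := by
    rintro ⟨r, u⟩ ⟨s, v⟩ ⟨h1 : s ≤ r, h2 : v ≤ u⟩ h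
    have := hp h1
    have := hp (Nat.zero_le s)
    simp only [Finset.coe_filter, Finset.mem_product, Finset.mem_range, Set.mem_ofPred_eq] at h ⊢
    omega

theorem rowLen_diagramOfRows {p : ℕ → ℕ} (hp : Antitone p) {n : ℕ} (hn : ∀ r, n ≤ r → p r = 0)
    (r : ℕ) : (diagramOfRows p hp n).rowLen r = p r := by
  refine eq_of_forall_lt_iff fun u => ?_
  rw [← YoungDiagram.mem_iff_lt_rowLen, ← YoungDiagram.mem_cells, diagramOfRows]
  simp only [Finset.mem_filter, Finset.mem_product, Finset.mem_range]
  have := hp (Nat.zero_le r)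
  have := hn r
  omega

theorem card_eq_sum_rowLen (P : YoungDiagram) {n : ℕ} (hn : ∀ r, n ≤ r → P.rowLen r = 0) :
    P.cells.card = ∑ r ∈ Finset.range n, P.rowLen r := by
  rw [Finset.card_eq_sum_card_fiberwise (f := Prod.fst) (t := Finset.range n)]
  · exact Finset.sum_congr rfl fun r _ => P.rowLen_eq_card.symm
  · rintro ⟨r, u⟩ hc
    have hc' : u < P.rowLen r := YoungDiagram.mem_iff_lt_rowLen.1 hc
    by_contra h
    have := hn r (by simpa using h)
    omega

theorem sum_ciSeq {d k : ℕ} (hk : 1 < k) :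
    ∑ i ∈ Finset.range (d + (k - 1) + d), ciSeq d k i = d * (d + k - 1) := by
  have h1 : ∀ i ∈ Finset.range d, ciSeq d k i = i + 1 := fun i hi =>
    if_pos (Finset.mem_range.1 hi)
  have h2 : ∀ i ∈ Finset.range (k - 1), ciSeq d k (d + i) = d := fun i hi => by
    have := Finset.mem_range.1 hi
    rw [ciSeq, if_neg (by omega), if_pos (by omega)]
  have h3 : ∀ i ∈ Finset.range d, ciSeq d k (d + (k - 1) + i) = d - 1 - i := fun i hi => by
    have := Finset.mem_range.1 hi
    rw [ciSeq, if_neg (by omega), if_neg (by omega)]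
    omega
  rw [Finset.sum_range_add, Finset.sum_range_add, Finset.sum_congr rfl h1, Finset.sum_congr rfl h2,
    Finset.sum_congr rfl h3, Finset.sum_range_reflect (fun i => i), Finset.sum_const,
    Finset.card_range, smul_eq_mul, add_right_comm, ← Finset.sum_add_distrib]
  have h4 : 2 * ∑ i ∈ Finset.range d, i = d * (d - 1) := by
    rw [mul_comm, Finset.sum_range_id_mul_two]
  have h5 : ∑ i ∈ Finset.range d, (i + 1 + i) = d * d := by
    rw [Finset.sum_congr rfl fun i _ => show i + 1 + i = 2 * i + 1 by ring, Finset.sum_add_distrib,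
      ← Finset.mul_sum, h4]
    cases d with
    | zero => simp
    | succ d => simp; ring
  rw [h5]
  obtain ⟨j, rfl⟩ := Nat.exists_eq_add_of_lt hk
  have : 1 + j + 1 - 1 = j + 1 := by omega
  have h6 : d + (1 + j + 1) - 1 = d + (j + 1) := by omega
  rw [this, h6]
  ring

theorem card_of_diagLength {d k : ℕ} (hk : 1 < k) {P : YoungDiagram}
    (hP : ∀ i, diagLength P i = ciSeq d k i) : P.cells.card = d * (d + k - 1) := by
  rw [← sum_ciSeq hk,
    Finset.card_eq_sum_card_fiberwise (f := fun c : ℕ × ℕ => c.1 + c.2)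
      (t := Finset.range (d + (k - 1) + d))]
  · exact Finset.sum_congr rfl fun i _ => hP i
  · intro c hc
    have h1 : 0 < diagLength P (c.1 + c.2) :=
      Finset.card_pos.2 ⟨c, Finset.mem_filter.2 ⟨hc, rfl⟩⟩
    rw [hP, ciSeq] at h1
    simp only [Finset.coe_range, Set.mem_Iio]
    split_ifs at h1 <;> omega

end Diagrams

/-! ### Translation between labels and row lengths -/

section Labels

/-- The entries of the label attached to `e` and to the breakpoints `a`. -/
def labelEntry (d e : ℕ) (a : ℕ → ℕ) (i : ℕ) : ℤ :=
  if i = e then 0 else if i < e then i + 1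
  else (d : ℤ) + 1 + (i - e - 1 : ℕ) - a (blockIdx a (i - e - 1)) - a (blockIdx a (i - e - 1) + 1)

variable {a : ℕ → ℕ}

/-- As `r` runs through `[a i, a (i+1))`, the value `d + 1 + r - a i - a (i+1)` climbs from `d - a
(i+1) + 1` to `d - a i`. -/
theorem flatten_intervals (ha : StrictMono a) (h0 : a 0 = 0) {d : ℕ} (c : ℕ) (hc : a c ≤ d) :
    ((List.range c).map fun i => interval (d - a (i + 1)) (d - a i)).flatten =
      (List.range (a c)).map fun r : ℕ =>
        (d : ℤ) + 1 + r - a (blockIdx a r) - a (blockIdx a r + 1) := by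
  induction c with
  | zero => simp [h0]
  | succ c ih =>
    have hlt : a c < a (c + 1) := ha (Nat.lt_succ_self c)
    obtain ⟨b, hb⟩ := Nat.exists_eq_add_of_lt hlt
    have hb' : a (c + 1) = a c + (b + 1) := by omega
    rw [List.range_succ, List.map_append, List.flatten_append, ih (by omega)]
    conv_rhs => rw [hb', List.range_add, List.map_append]
    congr 1
    rw [List.map_singleton, List.flatten_singleton, interval]
    apply List.ext_getElem
    · simp; omega
    · intro i h1 h2
      have hi : i < b + 1 := by simpa using h2
      simp only [List.getElem_map, List.getElem_range', List.getElem_range]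
      rw [blockIdx_eq ha h0 (i := c) (by omega) (by omega)]
      push_cast [Nat.cast_sub hc]
      ring

theorem label_eq_map (ha : StrictMono a) (h0 : a 0 = 0) {d e c : ℕ} (he : e ≤ d)
    (hc : a c = d - e) :
    interval 0 e ++ [0] ++
      ((List.range c).map fun i => interval (d - a (i + 1)) (d - a i)).flatten =
        (List.range (d + 1)).map (labelEntry d e a) := by
  rw [flatten_intervals ha h0 c (by omega), hc, show d + 1 = e + 1 + (d - e) by omega,
    List.range_add, List.range_succ, List.map_append, List.map_append, List.map_map]
  congr 1
  · congr 1
    · apply List.ext_getElem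
      · simp [interval]
      · intro i h1 h2
        have hi : i < e := by simpa using h2
        simp [interval, labelEntry, hi, hi.ne, add_comm]
    · simp [labelEntry]
  · refine List.map_congr_left fun r _ => ?_
    have h1 : e + 1 + r ≠ e := by omega
    have h2 : ¬ e + 1 + r < e := by omega
    have h3 : e + 1 + r - e - 1 = r := by omega
    simp [labelEntry, h1, h2, h3]

/-- There are `d + 1` monomials of degree `d` but only `d` boxes on that diagonal, so the search for
a gap succeeds instead of returning its default `0`. -/
theorem gapPos_notMem {d k : ℕ} (hk : 1 < k) {P : YoungDiagram}
    (hP : ∀ i, diagLength P i = ciSeq d k i) : (d - gapPos d P, gapPos d P) ∉ P := by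
  by_contra hmem
  have hall : ∀ i ≤ d, (d - i, i) ∈ P := by
    intro i hi
    by_contra hnot
    exact Nat.findGreatest_spec (P := fun i => (d - i, i) ∉ P) hi hnot hmem
  have hle : (Finset.range (d + 1)).card ≤ diagLength P d := by
    refine Finset.card_le_card_of_injOn (fun i => (d - i, i)) ?_ ?_
    · intro i hi
      have hi' : i < d + 1 := by simpa using hi
      simp only [Finset.coe_filter, Set.mem_ofPred_eq]
      exact ⟨hall i (by omega), by omega⟩
    · intro i _ j _ hij
      exact (Prod.ext_iff.1 hij).2
  rw [hP, ciSeq, if_neg (by omega), if_pos (by omega), Finset.card_range] at hle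
  omega

theorem branchLabel_eq_iff {d k : ℕ} (hk : 1 < k) {P : YoungDiagram}
    (hP : ∀ i, diagLength P i = ciSeq d k i) (ha : StrictMono a) (h0 : a 0 = 0) {e c : ℕ}
    (he : e ≤ d) (hc : a c = d - e) :
    branchLabel d k P = (List.range (d + 1)).map (labelEntry d e a) ↔
      ∀ r, P.rowLen r = rowProfile d (d + k - 1) e a r := by
  have hblock : ∀ r, r < d - e → a (blockIdx a r) ≤ r ∧ a (blockIdx a r + 1) ≤ d - e := fun r hr =>
    ⟨apply_blockIdx_le h0 r, hc ▸ apply_blockIdx_succ_le ha h0 (hc.symm ▸ hr)⟩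
  have hmax : max 0 ((k : ℤ) - 2) = k - 2 := max_eq_right (by omega)
  rw [branchLabel, List.map_inj_left]
  simp only [List.mem_range]
  constructor
  · intro h
    have hgap : gapPos d P = e := by
      have hle : gapPos d P ≤ d := Nat.findGreatest_le d
      -- The branch label vanishes at the gap, whereas the entries of the interval label are
      -- positive away from `e`.
      have h1 := h (gapPos d P) (by omega)
      rw [branchEntry, if_pos rfl, labelEntry] at h1
      split_ifs at h1 with h2 h3
      · exact h2
      · omega
      · have := hblock (gapPos d P - e - 1) (by omega)
        omega
    have hnot := gapPos_notMem hk hP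
    rw [hgap, YoungDiagram.mem_iff_lt_rowLen, not_lt] at hnot
    -- The first `e` columns have full height `d + k - 1`. Together with the gap at `(d - e, e)`
    -- this determines all rows from `d - e` on.
    have hcol : ∀ i < e, P.colLen i = d + k - 1 := by
      intro i hi
      have h1 := h i (by omega)
      rw [branchEntry, labelEntry, hgap, if_neg hi.ne, if_pos hi, if_neg hi.ne, if_pos hi,
        hmax] at h1
      omega
    have hcol' : ∀ r, ∀ i < e, i < P.rowLen r ↔ r < d + k - 1 := by
      intro r i hi
      rw [← YoungDiagram.mem_iff_lt_rowLen, YoungDiagram.mem_iff_lt_colLen, hcol i hi]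
    intro r
    rw [rowProfile]
    split_ifs with h1 h2
    · have h3 := h (r + e + 1) (by omega)
      rw [branchEntry, labelEntry, hgap, if_neg (by omega), if_neg (by omega), if_neg (by omega),
        if_neg (by omega), hmax, show r + e + 1 - e - 1 = r by omega] at h3
      have := hblock r h1
      push_cast at h3
      omega
    · have h3 := P.rowLen_anti (d - e) r (by omega)
      rcases Nat.eq_zero_or_pos e with rfl | he0
      · omega
      · have := (hcol' r (e - 1) (by omega)).2 h2
        omega
    · have h3 := P.rowLen_anti (d - e) r (by omega)
      rcases Nat.eq_zero_or_pos e with rfl | he0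
      · omega
      · have := (hcol' r 0 (by omega)).not.2 h2
        omega
  · intro h i hi
    have hgap : gapPos d P = e := by
      refine Nat.findGreatest_eq_iff.2 ⟨he, fun _ => ?_, fun i h1 h2 => ?_⟩
      · rw [YoungDiagram.mem_iff_lt_rowLen, h, rowProfile, if_neg (by omega), if_pos (by omega)]
        omega
      · rw [not_not, YoungDiagram.mem_iff_lt_rowLen, h, rowProfile, if_pos (by omega)]
        have := hblock (d - i) (by omega)
        omega
    rw [branchEntry, labelEntry, hgap, hmax]
    split_ifs with h1 h2
    · rfl
    · have hcol : P.colLen i = d + k - 1 := by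
        refine eq_of_forall_lt_iff fun r => ?_
        rw [← YoungDiagram.mem_iff_lt_colLen, YoungDiagram.mem_iff_lt_rowLen, h, rowProfile]
        split_ifs with h3 h4
        · have := hblock r h3
          omega
        · omega
        · omega
      omega
    · rw [h, rowProfile, if_pos (by omega)]
      have := hblock (i - e - 1) (by omega)
      omega

/-- Infinite strictly increasing sequences are more convenient for `blockIdx`; the terms beyond `c`
do not matter, so the finite sequence is continued with step one. -/
theorem exists_fin_label_iff (d e : ℕ) (B : List ℤ) :
    (∃ (c : ℕ) (a : Fin (c + 1) → ℕ), StrictMono a ∧ a 0 = 0 ∧ a (Fin.last c) = d - e ∧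
        B = interval 0 e ++ [0] ++ (List.ofFn fun i : Fin c =>
          interval (d - a i.succ) (d - a i.castSucc)).flatten) ↔
      ∃ (c : ℕ) (a : ℕ → ℕ), StrictMono a ∧ a 0 = 0 ∧ a c = d - e ∧
        B = interval 0 e ++ [0] ++
          ((List.range c).map fun i => interval (d - a (i + 1)) (d - a i)).flatten := by
  have hlist : ∀ (c : ℕ) (a : ℕ → ℕ) (a' : Fin (c + 1) → ℕ), (∀ i, a' i = a i) →
      (List.ofFn fun i : Fin c => interval (d - a' i.succ) (d - a' i.castSucc)) =
        (List.range c).map fun i => interval (d - a (i + 1)) (d - a i) := by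
    intro c a a' h
    apply List.ext_getElem
    · simp
    · intro i h1 h2
      simp [h]
  constructor
  · rintro ⟨c, a', hmono, h0, hc, hB⟩
    let a : ℕ → ℕ := fun i => if h : i < c + 1 then a' ⟨i, h⟩ else d - e + (i - c)
    have ha : ∀ i : Fin (c + 1), a' i = a i := fun i => by
      simp only [a, dif_pos i.2]
    refine ⟨c, a, strictMono_nat_of_lt_succ fun i => ?_, ?_, ?_, ?_⟩
    · rcases lt_trichotomy i c with h | rfl | h
      · simp only [a, dif_pos (show i < c + 1 by omega), dif_pos (show i + 1 < c + 1 by omega)]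
        exact hmono (Fin.mk_lt_mk.2 (Nat.lt_succ_self i))
      · have : a i = d - e := by rw [← hc, ha, Fin.val_last]
        rw [this]
        simp [a]
      · simp only [a, dif_neg (show ¬ i < c + 1 by omega), dif_neg (show ¬ i + 1 < c + 1 by omega)]
        omega
    · exact (ha 0).symm.trans h0
    · exact (ha (Fin.last c)).symm.trans hc
    · rw [hB, hlist c a a' ha]
  · rintro ⟨c, a, hmono, h0, hc, hB⟩
    refine ⟨c, fun i => a i, fun i j hij => hmono hij, by simpa using h0, by simpa using hc, ?_⟩
    rw [hB, hlist c a _ fun _ => rfl]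

end Labels

end CIJordan

namespace CIJordan

/-! ### Euclidean algorithm and string generators -/

section Euclid

open Polynomial

variable {K : Type*} [Field K] {J : Ideal (MvPolynomial (Fin 2) K)}

theorem natDegree_div_le (p : K[X]) {q : K[X]} (hq : q ≠ 0) :
    (p / q).natDegree ≤ p.natDegree - q.natDegree := by
  rcases lt_or_ge p.degree q.degree with h | h
  · rw [(Polynomial.div_eq_zero_iff hq).2 h]
    simp
  · have h1 := degree_add_div hq h
    have hp : p ≠ 0 := by
      rintro rfl
      exact hq (degree_eq_bot.1 (le_bot_iff.1 (by simpa using h)))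
    have h2 : p / q ≠ 0 := fun h0 => (not_lt_of_ge h) ((Polynomial.div_eq_zero_iff hq).1 h0)
    rw [degree_eq_natDegree hq, degree_eq_natDegree hp, degree_eq_natDegree h2] at h1
    norm_cast at h1
    omega

/-- The blocks of `a` up to the index `c` consist of degrees in which there are generators of
strings of the length predicted by the breakpoints. -/
def HasBlocks (J : Ideal (MvPolynomial (Fin 2) K)) (N c : ℕ) (a : ℕ → ℕ) : Prop :=
  ∀ i < c, ∀ r, a i ≤ r → r < a (i + 1) →
    ∃ h : K[X], h.natDegree = r ∧ h ≠ 0 ∧ h ∈ affinePart J (N - a i - a (i + 1) + r)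

theorem exists_of_mem_affinePart {p : K[X]} (hp : p ≠ 0) {t r s : ℕ} (hr : p.natDegree ≤ r)
    (hpt : p ∈ affinePart J t) (hs : t + (r - p.natDegree) ≤ s) :
    ∃ h : K[X], h.natDegree = r ∧ h ≠ 0 ∧ h ∈ affinePart J s := by
  have hX : (X ^ (r - p.natDegree) : K[X]) ≠ 0 := pow_ne_zero _ X_ne_zero
  refine ⟨X ^ (r - p.natDegree) * p, ?_, mul_ne_zero hX hp,
    mul_mem_affinePart (natDegree_X_pow_le _) hpt (by omega)⟩
  rw [natDegree_mul hX hp, natDegree_X_pow]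
  omega

/-- The degrees of the remainders in the Euclidean algorithm are breakpoints. -/
theorem exists_hasBlocks {N : ℕ} (ρ : ℕ) : ∀ p q : K[X], p.natDegree = ρ → p ≠ 0 →
    q.degree < p.degree → IsCoprime p q → 2 * ρ ≤ N → p ∈ affinePart J (N - ρ) →
    q ∈ affinePart J (N - ρ) →
    ∃ (c : ℕ) (a : ℕ → ℕ), StrictMono a ∧ a 0 = 0 ∧ a c = ρ ∧ HasBlocks J N c a := by
  induction ρ using Nat.strong_induction_on with
  | _ ρ ih =>
    intro p q hpρ hp hlt hcop hN hpJ hqJ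
    rcases Nat.eq_zero_or_pos ρ with rfl | hρ
    · exact ⟨0, id, strictMono_id, rfl, rfl, fun i hi => absurd hi (Nat.not_lt_zero i)⟩
    have hq : q ≠ 0 := by
      rintro rfl
      have := natDegree_eq_zero_of_isUnit (isCoprime_zero_right.1 hcop)
      omega
    have hqρ : q.natDegree < ρ := hpρ ▸ natDegree_lt_natDegree hq hlt
    have hmod : p % q = p - p / q * q := by
      rw [eq_sub_iff_add_eq, mul_comm, add_comm]
      exact EuclideanDomain.div_add_mod p q
    obtain ⟨c, a, hmono, h0, hc, hblocks⟩ := ih q.natDegree hqρ q (p % q) rfl hq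
      (degree_mod_lt p hq) (by
        rw [hmod, sub_eq_add_neg, ← neg_mul, mul_comm]
        exact hcop.symm.add_mul_left_right _) (by omega)
      -- The quotient has degree at most `ρ - deg q`, so the remainder is reached in degree `N - deg
      -- q`, as the induction requires.
      (affinePart_mono (by omega) hqJ) (by
        rw [hmod]
        refine Submodule.sub_mem _ (affinePart_mono (by omega) hpJ)
          (mul_mem_affinePart (natDegree_div_le p hq) hqJ (by omega)))
    -- The breakpoint `ρ` is appended at index `c + 1`; the values beyond it only preserve strict
    -- monotonicity.
    let a' : ℕ → ℕ := fun i => if i ≤ c then a i else ρ + (i - (c + 1))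
    have ha' : ∀ i ≤ c, a' i = a i := fun i hi => if_pos hi
    have hac : a' (c + 1) = ρ := by simp [a']
    refine ⟨c + 1, a', strictMono_nat_of_lt_succ fun i => ?_, ?_, hac, ?_⟩
    · rcases lt_trichotomy i c with h | rfl | h
      · rw [ha' i h.le, ha' _ h]
        exact hmono (Nat.lt_succ_self i)
      · rw [ha' i le_rfl, hac, hc]
        exact hqρ
      · simp only [a', if_neg (show ¬ i ≤ c by omega), if_neg (show ¬ i + 1 ≤ c by omega)]
        omega
    · rw [ha' 0 (Nat.zero_le c), h0]
    · intro i hi r h1 h2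
      rcases (Nat.lt_succ_iff.1 hi).lt_or_eq with hic | rfl
      · rw [ha' i hic.le] at h1 ⊢
        rw [ha' (i + 1) hic] at h2 ⊢
        exact hblocks i hic r h1 h2
      · rw [ha' i le_rfl, hc] at h1 ⊢
        rw [hac] at h2 ⊢
        exact exists_of_mem_affinePart hq h1 hqJ (by omega)

/-- Polynomials whose successive quotients in the Euclidean algorithm are powers of `X`, with the
degrees prescribed by `a`. -/
noncomputable def continuant (K : Type*) [Field K] (a : ℕ → ℕ) : ℕ → K[X]
  | 0 => 0
  | 1 => 1
  | i + 2 => X ^ (a (i + 1) - a i) * continuant K a (i + 1) + continuant K a i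

theorem degree_continuant {a : ℕ → ℕ} (ha : StrictMono a) (h0 : a 0 = 0) (i : ℕ) :
    (continuant K a (i + 1)).degree = (a i : WithBot ℕ) ∧
      (continuant K a i).degree < (continuant K a (i + 1)).degree := by
  induction i with
  | zero => simp [continuant, h0]
  | succ i ih =>
    have hlt : a i < a (i + 1) := ha (Nat.lt_succ_self i)
    have h1 : (X ^ (a (i + 1) - a i) * continuant K a (i + 1)).degree =
        ((a (i + 1) : ℕ) : WithBot ℕ) := by
      rw [degree_mul, degree_X_pow, ih.1]
      norm_cast
      omega
    have h2 : (continuant K a (i + 2)).degree = ((a (i + 1) : ℕ) : WithBot ℕ) := by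
      rw [continuant, degree_add_eq_left_of_degree_lt, h1]
      rw [h1]
      exact ih.2.trans (by rw [ih.1]; exact_mod_cast hlt)
    exact ⟨h2, by rw [h2, ih.1]; exact_mod_cast hlt⟩

theorem natDegree_continuant {a : ℕ → ℕ} (ha : StrictMono a) (h0 : a 0 = 0) (i : ℕ) :
    (continuant K a (i + 1)).natDegree = a i :=
  natDegree_eq_of_degree_eq_some (degree_continuant ha h0 i).1

theorem continuant_succ_ne_zero {a : ℕ → ℕ} (ha : StrictMono a) (h0 : a 0 = 0) (i : ℕ) :
    continuant K a (i + 1) ≠ 0 := fun h => by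
  simpa [h] using (degree_continuant (K := K) ha h0 i).1

/-- Running the recurrence downwards is the Euclidean algorithm: each continuant is obtained from
the two above it, at the cost of the quotient degree `a (i+1) - a i`. -/
theorem hasBlocks_continuant {a : ℕ → ℕ} (ha : StrictMono a) (h0 : a 0 = 0) {N c : ℕ}
    (hN : 2 * a c ≤ N) (h1 : continuant K a (c + 1) ∈ affinePart J (N - a c))
    (h2 : continuant K a c ∈ affinePart J (N - a c)) : HasBlocks J N c a := by
  have key : ∀ i, i ≤ c → continuant K a (i + 1) ∈ affinePart J (N - a i) ∧
      continuant K a i ∈ affinePart J (N - a i) := by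
    intro i hi
    induction hi using Nat.decreasingInduction with
    | self => exact ⟨h1, h2⟩
    | of_succ i hi ih =>
      have hlt : a i < a (i + 1) := ha (Nat.lt_succ_self i)
      have hle : a (i + 1) ≤ a c := ha.monotone hi
      refine ⟨affinePart_mono (by omega) ih.2, ?_⟩
      have h3 : continuant K a i = continuant K a (i + 2) -
          X ^ (a (i + 1) - a i) * continuant K a (i + 1) := by
        rw [continuant, add_sub_cancel_left]
      rw [h3]
      exact Submodule.sub_mem _ (affinePart_mono (by omega) ih.1)
        (mul_mem_affinePart (natDegree_X_pow_le _) ih.2 (by omega))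
  intro i hi r h3 h4
  have hle : a (i + 1) ≤ a c := ha.monotone hi
  refine exists_of_mem_affinePart (continuant_succ_ne_zero ha h0 i)
    ((natDegree_continuant ha h0 i).le.trans h3) (key (i + 1) hi).2 ?_
  rw [natDegree_continuant ha h0]
  omega

/-- Generators of strings in the degrees covered by blocks extend to a string system for the ideal
generated by the homogenizations of `F` and `G`. -/
theorem exists_isStringSystem {d n e c : ℕ} {a : ℕ → ℕ} (he : e ≤ d)
    (ha : StrictMono a) (h0 : a 0 = 0) (hc : a c = d - e) {F G : K[X]} (hF : F.natDegree = d - e)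
    (hF0 : F ≠ 0) (hFJ : F ∈ affinePart J d) (hGJ : G ∈ affinePart J n)
    (hG : e = 0 ∨ G ≠ 0 ∧ G.natDegree = n) (hblocks : HasBlocks J (n + d) c a) {Q : YoungDiagram}
    (hQ : ∀ r, Q.rowLen r = rowProfile d n e a r) : ∃ h, IsStringSystem J Q h := by
  have hex : ∀ r, ∃ h : K[X], h.natDegree = r ∧ h ≠ 0 ∧ h ∈ affinePart J (Q.rowLen r + r) := by
    intro r
    rw [hQ, rowProfile]
    split_ifs with h1 h2
    · exact hblocks _ (ha.lt_iff_lt.1 ((apply_blockIdx_le h0 r).trans_lt (hc ▸ h1))) r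
        (apply_blockIdx_le h0 r) (lt_apply_blockIdx_succ ha r)
    · exact exists_of_mem_affinePart hF0 (by omega) hFJ (by omega)
    -- Rows from `n` on have length `0`, so they need elements with no degree drop: multiples of `F`
    -- if `e = 0`, of `G` otherwise.
    · rcases hG with rfl | ⟨hG0, hGn⟩
      · exact exists_of_mem_affinePart hF0 (by omega) hFJ (by omega)
      · exact exists_of_mem_affinePart hG0 (by omega) hGJ (by omega)
  choose h h1 h2 h3 using hex
  exact ⟨h, h1, h2, h3⟩

theorem IsStringSystem.finrank_le {Q : YoungDiagram} {h : ℕ → K[X]} (H : IsStringSystem J Q h) :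
    Module.finrank K (MvPolynomial (Fin 2) K ⧸ J) ≤ Q.cells.card := by
  have := finrank_range_le_card (R := K) fun c : Q.cells => stringVec J h c
  rwa [Set.finrank, top_le_iff.1 H.span_eq_top, finrank_top, Fintype.card_coe] at this

/-- A complete intersection generated in degrees `d ≤ n` which contains powers of both variables
has a string system with rows given by breakpoints. -/
theorem exists_breakpoints {d n N : ℕ} (hdn : d ≤ n) {F G : K[X]}
    (hF : F.natDegree ≤ d) (hG : G.natDegree ≤ n) (hF0 : F ≠ 0)
    (hJ : J = Ideal.span {F.homogenize d, G.homogenize n}) (hX0 : MvPolynomial.X 0 ^ N ∈ J)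
    (hX1 : MvPolynomial.X 1 ^ N ∈ J) :
    ∃ (e c : ℕ) (a : ℕ → ℕ), e ≤ d ∧ StrictMono a ∧ a 0 = 0 ∧ a c = d - e ∧
      ∀ Q : YoungDiagram, (∀ r, Q.rowLen r = rowProfile d n e a r) → ∃ h, IsStringSystem J Q h := by
  have hFJ : F ∈ affinePart J d := ⟨hF, hJ ▸ Ideal.subset_span (by simp)⟩
  have hGJ : G ∈ affinePart J n := ⟨hG, hJ ▸ Ideal.subset_span (by simp)⟩
  -- Setting `X 1 = 1` turns the membership of a power of `X 1` into a Bézout identity.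
  have hcop : IsCoprime F G := by
    rw [hJ] at hX1
    obtain ⟨α, β, h⟩ := Ideal.mem_span_pair.1 hX1
    have h' := congrArg (MvPolynomial.aeval ![X, 1] : MvPolynomial (Fin 2) K →ₐ[K] K[X]) h
    rw [map_add, map_mul, map_mul, aeval_homogenize_X_one _ hF, aeval_homogenize_X_one _ hG] at h'
    exact ⟨_, _, h'.trans (by simp)⟩
  have heval : ∀ (p : K[X]) (t : ℕ), p.coeff t = 0 →
      (MvPolynomial.aeval ![X, 0] : MvPolynomial (Fin 2) K →ₐ[K] K[X]) (p.homogenize t) = 0 := by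
    intro p t hp
    rw [homogenize, map_sum]
    refine Finset.sum_eq_zero fun kl hkl => ?_
    have hkl' : kl.1 + kl.2 = t := Finset.HasAntidiagonal.mem_antidiagonal.1 hkl
    rw [MvPolynomial.aeval_monomial, Finsupp.prod_fintype _ _ (by simp), Fin.prod_univ_two]
    by_cases h1 : kl.2 = 0
    · rw [show kl.1 = t by omega, hp]
      simp
    · simp [h1]
  -- Otherwise `X 1` would divide both generators, and setting `X 1 = 0` would kill a power of `X
  -- 0`.
  have hGn : d - F.natDegree = 0 ∨ G ≠ 0 ∧ G.natDegree = n := by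
    by_contra! hcon
    have hFd : F.coeff d = 0 := coeff_eq_zero_of_natDegree_lt (by omega)
    have hGn' : G.coeff n = 0 := by
      by_cases hG0 : G = 0
      · simp [hG0]
      · exact coeff_eq_zero_of_natDegree_lt (lt_of_le_of_ne hG (hcon.2 hG0))
    rw [hJ] at hX0
    obtain ⟨α, β, h⟩ := Ideal.mem_span_pair.1 hX0
    have h' := congrArg (MvPolynomial.aeval ![X, 0] : MvPolynomial (Fin 2) K →ₐ[K] K[X]) h
    rw [map_add, map_mul, map_mul, heval F d hFd, heval G n hGn'] at h'
    simp at h'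
    exact pow_ne_zero N X_ne_zero h'.symm
  have hmod : G % F = G - G / F * F := by
    rw [eq_sub_iff_add_eq, mul_comm, add_comm]
    exact EuclideanDomain.div_add_mod G F
  have hdiv := natDegree_div_le G hF0
  obtain ⟨c, a, ha, h0, hc, hblocks⟩ := exists_hasBlocks (J := J) (N := n + d) F.natDegree F (G % F)
    rfl hF0 (degree_mod_lt G hF0) (by
        rw [hmod, sub_eq_add_neg, ← neg_mul, mul_comm]
        exact hcop.add_mul_left_right _) (by omega) (affinePart_mono (by omega) hFJ) (by
        rw [hmod]
        exact Submodule.sub_mem _ (affinePart_mono (by omega) hGJ)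
          (mul_mem_affinePart hdiv hFJ (by omega)))
  have hde : d - (d - F.natDegree) = F.natDegree := by omega
  exact ⟨d - F.natDegree, c, a, Nat.sub_le _ _, ha, h0, by rw [hc, hde], fun Q hQ =>
    exists_isStringSystem (Nat.sub_le _ _) ha h0 (by rw [hc, hde]) hde.symm hF0 hFJ hGJ hGn
      hblocks hQ⟩

end Euclid

/-! ### The two implications -/

section Main

variable {K : Type*} [Field K]

open MvPolynomial

theorem rowProfile_of_isCIJT {d k : ℕ} (hd : 2 ≤ d) (hk : 1 < k) {P : YoungDiagram}
    (hP : ∀ i, diagLength P i = ciSeq d k i) (h : IsCIJT K (ciSeq d k) P) :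
    ∃ (e c : ℕ) (a : ℕ → ℕ), e ≤ d ∧ StrictMono a ∧ a 0 = 0 ∧ a c = d - e ∧
      ∀ r, P.rowLen r = rowProfile d (d + k - 1) e a r := by
  obtain ⟨-, I, hI, hT, l, hl, hJT⟩ := h
  -- Two boxes of degree one put `(0, 1)` in the diagram, so the first row has a nontrivial Jordan
  -- arrow.
  have hl0 : l ≠ 0 := by
    rintro rfl
    have h01 : (0, 1) ∈ P.cells := by
      have h2 : diagLength P 1 = 2 := by rw [hP, ciSeq, if_pos (by omega)]
      by_contra hnot
      have : diagLength P 1 ≤ ({(1, 0)} : Finset (ℕ × ℕ)).card := by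
        refine Finset.card_le_card fun c hc => ?_
        obtain ⟨hc1, hc2⟩ := Finset.mem_filter.1 hc
        obtain ⟨r, u⟩ := c
        rw [Finset.mem_singleton, Prod.mk.injEq]
        by_contra hne
        have hr : r = 0 := by simp only at hc2; omega
        have hu : u = 1 := by simp only at hc2; omega
        exact hnot (hr ▸ hu ▸ hc1)
      rw [h2] at this
      simp at this
    obtain ⟨b, hb⟩ := hJT
    have h00 : (0, 0) ∈ P.cells := P.up_left_mem le_rfl (Nat.zero_le 1) h01
    have h1 := hb ⟨(0, 0), h00⟩
    rw [dif_pos h01] at h1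
    refine b.ne_zero _ (h1.symm.trans ?_)
    simp
  obtain ⟨f, g, n, hspan, hf, hf0, hg, hdn, hnk⟩ := exists_generators hd hk hI hT
  obtain ⟨ψ, hψ, hhom, hhom'⟩ := exists_coordinates hl hl0
  set J : Ideal (MvPolynomial (Fin 2) K) := I.map (ψ.symm : _ →+* _) with hJ
  have hmem : ∀ z, ψ z ∈ I → z ∈ J := fun z hz => by
    have := Ideal.mem_map_of_mem (ψ.symm : MvPolynomial (Fin 2) K →+* MvPolynomial (Fin 2) K) hz
    simpa using this
  have hJT' : HasJordanType (LinearMap.mulLeft K (Ideal.Quotient.mk J (X 1))) P := by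
    refine hJT.conj (Ideal.quotientEquivAlg I J ψ.symm hJ).toLinearEquiv fun v => ?_
    have h1 : Ideal.quotientEquivAlg I J ψ.symm hJ (Ideal.Quotient.mk I l) =
        Ideal.Quotient.mk J (X 1) := by
      rw [← hψ]
      simp
    simp [h1]
  have hpow : ∀ i : Fin 2, (X i : MvPolynomial (Fin 2) K) ^ (2 * d + k) ∈ J := fun i => by
    refine hmem _ (mem_of_hilbertFn_eq_zero (m := 2 * d + k) ?_ (hhom _ _ (isHomogeneous_X_pow i _)))
    rw [hT, ciSeq, if_neg (by omega), if_neg (by omega)]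
    omega
  have hFh := Polynomial.homogenize_eq_of_isHomogeneous (hhom' f d hf) rfl
  have hGh := Polynomial.homogenize_eq_of_isHomogeneous (hhom' g n hg) rfl
  have hF0 : (aeval ![Polynomial.X, 1] (ψ.symm f) : Polynomial K) ≠ 0 := by
    intro h
    rw [h, Polynomial.homogenize_zero] at hFh
    exact hf0 (by simpa using hFh.symm)
  obtain ⟨e, c, a, he, ha, h0, hc, hstring⟩ := exists_breakpoints (J := J) hdn
    (natDegree_aeval_le (hhom' f d hf)) (natDegree_aeval_le (hhom' g n hg)) hF0
    (by
      rw [hFh, hGh, hJ, hspan, Ideal.map_span, Set.image_pair]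
      rfl) (hpow 0) (hpow 1)
  have hvanish : ∀ r, n ≤ r → rowProfile d n e a r = 0 := fun r hr => by
    rw [rowProfile, if_neg (by omega), if_neg (by omega)]
  set Q := diagramOfRows _ (rowProfile_antitone ha h0 hc) n
  have hQ : ∀ r, Q.rowLen r = rowProfile d n e a r := rowLen_diagramOfRows _ hvanish
  obtain ⟨h, H⟩ := hstring Q hQ
  have hQcard : Q.cells.card = d * n := by
    rw [card_eq_sum_rowLen Q fun r hr => (hQ r).trans (hvanish r hr),
      Finset.sum_congr rfl fun r _ => hQ r, sum_rowProfile hdn he ha h0 hc]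
  have hfin := hJT'.finrank_eq
  rw [card_of_diagLength hk hP] at hfin
  have hle := H.finrank_le
  rw [hfin, hQcard] at hle
  -- The quotient has dimension `d * (d + k - 1)` and is spanned by `d * n` vectors.
  obtain rfl : n = d + k - 1 := le_antisymm hnk (Nat.le_of_mul_le_mul_left hle (by omega))
  have hPQ : P = Q := hJT'.unique (H.hasJordanType_of_finrank (hQcard.trans hfin.symm))
  exact ⟨e, c, a, he, ha, h0, hc, hPQ ▸ hQ⟩

attribute [local instance] MvPolynomial.gradedAlgebra in
theorem isCIJT_of_rowProfile {d k : ℕ} (hd : 2 ≤ d) (hk : 1 < k) {P : YoungDiagram}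
    (hP : ∀ i, diagLength P i = ciSeq d k i) {e c : ℕ} {a : ℕ → ℕ} (he : e ≤ d) (ha : StrictMono a)
    (h0 : a 0 = 0) (hc : a c = d - e)
    (hrow : ∀ r, P.rowLen r = rowProfile d (d + k - 1) e a r) : IsCIJT K (ciSeq d k) P := by
  set n := d + k - 1 with hn
  set F : Polynomial K := continuant K a (c + 1) with hF
  -- One more Euclidean step: `G` has degree exactly `n`, and its remainder modulo `F` is the
  -- preceding continuant.
  set G : Polynomial K := continuant K a c + Polynomial.X ^ (n - a c) * F with hG
  have hFdeg : F.natDegree = d - e := (natDegree_continuant ha h0 c).trans hc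
  have hF0 : F ≠ 0 := continuant_succ_ne_zero ha h0 c
  have hXF : (Polynomial.X ^ (n - a c) * F).degree = (n : WithBot ℕ) := by
    rw [Polynomial.degree_mul, Polynomial.degree_X_pow, (degree_continuant ha h0 c).1]
    norm_cast
    omega
  have hGdeg : G.degree = (n : WithBot ℕ) := by
    rw [hG, Polynomial.degree_add_eq_right_of_degree_lt, hXF]
    rw [hXF]
    refine (degree_continuant ha h0 c).2.trans_le ?_
    rw [(degree_continuant ha h0 c).1]
    norm_cast
    omega
  have hGn : G.natDegree = n := Polynomial.natDegree_eq_of_degree_eq_some hGdeg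
  have hG0 : G ≠ 0 := fun h => by simp [h] at hGdeg
  set f := F.homogenize d
  set g := G.homogenize n
  have hf : f.IsHomogeneous d := Polynomial.isHomogeneous_homogenize F
  have hg : g.IsHomogeneous n := Polynomial.isHomogeneous_homogenize G
  set J : Ideal (MvPolynomial (Fin 2) K) := Ideal.span {f, g} with hJ
  have hFJ : F ∈ affinePart J d := ⟨by omega, Ideal.subset_span (Or.inl rfl)⟩
  have hGJ : G ∈ affinePart J n := ⟨hGn.le, Ideal.subset_span (Or.inr rfl)⟩
  have hblocks : HasBlocks J (n + d) c a := by
    refine hasBlocks_continuant ha h0 (by omega) (affinePart_mono (by omega) hFJ) ?_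
    rw [show continuant K a c = G - Polynomial.X ^ (n - a c) * F by rw [hG, add_sub_cancel_right]]
    exact Submodule.sub_mem _ (affinePart_mono (by omega) hGJ)
      (mul_mem_affinePart (Polynomial.natDegree_X_pow_le _) hFJ (by omega))
  obtain ⟨h, H⟩ := exists_isStringSystem (n := n) he ha h0 hc hFdeg hF0 hFJ hGJ
    (Or.inr ⟨hG0, hGn⟩) hblocks hrow
  have hlow : ∀ i, ciSeq d k i ≤ hilbertFn J i := by
    intro i
    have := le_hilbertFn_span_pair hf hg i
    rw [← hJ] at this
    rw [ciSeq]
    split_ifs <;> omega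
  have hT : ∀ i, hilbertFn J i = ciSeq d k i := fun i =>
    le_antisymm (hP i ▸ H.hilbertFn_le i) (hlow i)
  have hhom : J.IsHomogeneous (homogeneousSubmodule (Fin 2) K) := by
    refine Ideal.homogeneous_span _ _ ?_
    rintro x (rfl | rfl)
    · exact ⟨d, hf⟩
    · exact ⟨n, hg⟩
  refine ⟨hP, J, ⟨?_, H.finite, f, g, ⟨d, hf⟩, ⟨n, hg⟩, hJ⟩, hT, X 1, isHomogeneous_X K 1,
    H.hasJordanType (H.linearIndependent hhom fun i => by rw [hP]; exact hlow i)⟩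
  intro htop
  have h1 := hT 0
  rw [ciSeq, if_pos (by omega)] at h1
  have : Subsingleton (MvPolynomial (Fin 2) K ⧸ J) := Ideal.Quotient.subsingleton_iff.2 htop
  rw [hilbertFn, Module.finrank_zero_of_subsingleton] at h1
  omega

end Main

end CIJordan

theorem theorem3p5 {K : Type*} [Field K] [Infinite K] (d k : ℕ) (hd : 2 ≤ d) (hk : 1 < k)
    (hchar : ringChar K = 0 ∨ 2 * d + k - 3 < ringChar K)
    (P : YoungDiagram) (hP : ∀ i, CIJordan.diagLength P i = CIJordan.ciSeq d k i) :
    CIJordan.IsCIJT K (CIJordan.ciSeq d k) P ↔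
      ∃ e ≤ d, ∃ (c : ℕ) (a : Fin (c + 1) → ℕ),
        StrictMono a ∧ a 0 = 0 ∧ a (Fin.last c) = d - e ∧
        CIJordan.branchLabel d k P =
          CIJordan.interval 0 e ++ [0] ++
            (List.ofFn fun i : Fin c =>
              CIJordan.interval (d - a i.succ) (d - a i.castSucc)).flatten := by
  simp only [CIJordan.exists_fin_label_iff]
  constructor
  · intro h
    obtain ⟨e, c, a, he, ha, h0, hc, hrow⟩ := CIJordan.rowProfile_of_isCIJT hd hk hP h
    refine ⟨e, he, c, a, ha, h0, hc, ?_⟩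
    rw [CIJordan.label_eq_map ha h0 he hc]
    exact (CIJordan.branchLabel_eq_iff hk hP ha h0 he hc).2 hrow
  · rintro ⟨e, he, c, a, ha, h0, hc, hlabel⟩
    rw [CIJordan.label_eq_map ha h0 he hc] at hlabel
    exact CIJordan.isCIJT_of_rowProfile hd hk hP he ha h0 hc
      ((CIJordan.branchLabel_eq_iff hk hP ha h0 he hc).1 hlabel)
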